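/- Let $d,T\ge 1$ be integers, let $\mathcal X\subseteq\{x\in\mathbb R^d:\|x\|_2\le 1\}$ be nonempty, let $\mathcal Y=[-1,1]$, $\ell(\hat y,y)=(\hat y-y)^2$, and let $c(a)=\max(-1,\min(1,a))$ denote clipping to $[-1,1]$. A strategy is a sequence of functions $\pi_t:\mathcal X^t\times\mathcal Y^{t-1}\to\mathcal Y$, $t\ge1$. For a set $\Pi$ of strategies the minimax regret of the $T$-round game is $$\mathcal V_T(\Pi)=\sup_{x_1\in\mathcal X}\inf_{q_1\in\Delta(\mathcal Y)}\sup_{y_1\in\mathcal Y}\mathbb E_{\hat y_1\sim q_1}\cdots\sup_{x_T\in\mathcal X}\inf_{q_T\in\Delta(\mathcal Y)}\sup_{y_T\in\mathcal Y}\mathbb E_{\hat y_T\sim q_T}\Big[\sum_{t=1}^T\ell(\hat y_t,y_t)-\inf_{\pi\in\Pi}\sum_{t=1}^T\ell(\pi_t(x_{1:t},y_{1:t-1}),y_t)\Big],$$ where $\Delta(\mathcal Y)$ is the set of probability distributions on $\mathcal Y$. For $\lambda\in(0,\infty)$ and $w_0\in\mathbb R^d$, the clipped regularized least squares strategy $\pi^{\lambda,w_0}$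 predicts $\pi_t^{\lambda,w_0}(x_{1:t},y_{1:t-1})=c(\langle w_t,x_t\rangle)$, where, with $X$ the matrix with rows $x_1,\dots,x_{t-1}$ and $Y=(y_1,\dots,y_{t-1})^{\mathsf T}$, the vector $w_t$ is either (a) $w_t=w_0+(X^{\mathsf T}X+\lambda I)^{-1}X^{\mathsf T}Y$, or (b) $w_t=\arg\min_{w\in\mathbb R^d}\ \sum_{i=1}^{t-1}(y_i-\langle x_i,w\rangle)^2+\lambda\|w-w_0\|_2^2$; for $\lambda=\infty$ one puts $w_t=w_0$. Given $\lambda_{\min}>0$, let $\Pi=\{\pi^{\lambda,w_0}:\lambda_{\min}\le\lambda\le\infty,\ \|w_0\|_2\le1\}$. There is an absolute constant $c>0$ (independent of $d$, $T$, $\mathcal X$ and $\lambda_{\min}$) such that, whenever $T\lambda_{\min}^{-1}\ge 2$, both for the class $\Pi$ defined with (a) and for the class $\Pi$ defined with (b), $$\mathcal V_T(\Pi)\le c\,\sqrt{T\log(T\lambda_{\min}^{-1})}.$$ -/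

import Mathlib

open MeasureTheory

noncomputable section

/-- A strategy for supervised prediction.  In round `t + 1` (rounds are numbered from `1`) it sees
the side information `x 0, …, x t` (the current one included) and the past outcomes
`y 0, …, y (t - 1)`, and it predicts an element of `Y`. -/
abbrev SupStrategy (X Y : Type*) : Type _ :=
  (t : ℕ) → (Fin (t + 1) → X) → (Fin t → Y) → Y

/-- Cumulative loss of a strategy on the data `(x 0, y 0), …, (x (n - 1), y (n - 1))`. -/
def strategyLoss {X Y : Type*} (loss : Y → Y → ℝ) (s : SupStrategy X Y) {n : ℕ}
    (x : Fin n → X) (y : Fin n → Y) : ℝ :=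
  ∑ t : Fin n,
    loss (s t (fun i => x (Fin.castLE t.isLt i)) (fun i => y (Fin.castLE t.isLt.le i))) (y t)

/-- Regret of the predictions `p` against the set `S` of strategies. -/
def supRegret {X Y : Type*} (loss : Y → Y → ℝ) (S : Set (SupStrategy X Y)) {n : ℕ}
    (x : Fin n → X) (p y : Fin n → Y) : ℝ :=
  (∑ t : Fin n, loss (p t) (y t)) - ⨅ s : S, strategyLoss loss s.1 x y

/-- Value of the remaining `k` rounds of the supervised game after the rounds with side
information `x`, predictions `p` and outcomes `y` have been played.  Each round is
`sup_{x} inf_{q} sup_{y} E_{prediction ~ q}`, where `q` ranges over the probability distributions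
on `Y`; at the end the learner pays the regret. -/
def supValueFrom {X Y : Type*} [MeasurableSpace Y] (loss : Y → Y → ℝ)
    (S : Set (SupStrategy X Y)) :
    (k : ℕ) → {n : ℕ} → (Fin n → X) → (Fin n → Y) → (Fin n → Y) → ℝ
  | 0, _, x, p, y => supRegret loss S x p y
  | k + 1, n, x, p, y =>
      ⨆ a : X, ⨅ q : ProbabilityMeasure Y, ⨆ b : Y,
        ∫ r, supValueFrom loss S k (n := n + 1)
          (Fin.snoc (α := fun _ => X) x a) (Fin.snoc (α := fun _ => Y) p r)
          (Fin.snoc (α := fun _ => Y) y b) ∂(q : Measure Y)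

/-- The minimax regret of the `T`-round supervised game against the set `S` of strategies. -/
def supValue {X Y : Type*} [MeasurableSpace Y] (loss : Y → Y → ℝ)
    (S : Set (SupStrategy X Y)) (T : ℕ) : ℝ :=
  supValueFrom loss S T (n := 0) Fin.elim0 Fin.elim0 Fin.elim0

/-- The outcome and prediction space `[-1, 1]`. -/
abbrev Outcome : Type := Set.Icc (-1 : ℝ) 1

/-- The square loss. -/
def squareLoss (p y : Outcome) : ℝ := ((p : ℝ) - (y : ℝ)) ^ 2

/-- Clipping a real number to `[-1, 1]`. -/
def clip (a : ℝ) : Outcome := Set.projIcc (-1 : ℝ) 1 (by norm_num) a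

/-- The `t × d` matrix whose rows are `x 0, …, x (t - 1)`. -/
def dataMatrix {d t : ℕ} (x : Fin t → EuclideanSpace ℝ (Fin d)) : Matrix (Fin t) (Fin d) ℝ :=
  Matrix.of fun i j => x i j

/-- The vector `w₀ + (XᵀX + lam I)⁻¹ XᵀY`. -/
def rlsWeight {d t : ℕ} (lam : ℝ) (w₀ : EuclideanSpace ℝ (Fin d))
    (x : Fin t → EuclideanSpace ℝ (Fin d)) (y : Fin t → ℝ) : EuclideanSpace ℝ (Fin d) :=
  w₀ + WithLp.toLp 2
    (((dataMatrix x).transpose * dataMatrix x + lam • (1 : Matrix (Fin d) (Fin d) ℝ))⁻¹.mulVec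
      ((dataMatrix x).transpose.mulVec y))

/-- The regularized least squares objective `∑ (y_i - ⟨x_i, w⟩)² + lam ‖w - w₀‖²`. -/
def rlsObjective {d t : ℕ} (lam : ℝ) (w₀ : EuclideanSpace ℝ (Fin d))
    (x : Fin t → EuclideanSpace ℝ (Fin d)) (y : Fin t → ℝ) (w : EuclideanSpace ℝ (Fin d)) : ℝ :=
  (∑ i, (y i - inner ℝ (x i) w) ^ 2) + lam * ‖w - w₀‖ ^ 2

/-- The static strategy `clip ⟨w₀, x_t⟩`, i.e. regularization parameter `∞`. -/
def staticStrategy {d : ℕ} (X : Set (EuclideanSpace ℝ (Fin d))) (w₀ : EuclideanSpace ℝ (Fin d)) :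
    SupStrategy X Outcome :=
  fun t x _ => clip (inner ℝ w₀ (x (Fin.last t) : EuclideanSpace ℝ (Fin d)))

/-- The clipped strategy that predicts with `w₀ + (XᵀX + lam I)⁻¹ XᵀY`, computed from the data of
all previous rounds. -/
def rlsStrategy {d : ℕ} (X : Set (EuclideanSpace ℝ (Fin d))) (lam : ℝ)
    (w₀ : EuclideanSpace ℝ (Fin d)) : SupStrategy X Outcome :=
  fun t x y => clip (inner ℝ
    (rlsWeight lam w₀ (fun i : Fin t => (x i.castSucc : EuclideanSpace ℝ (Fin d)))
      (fun i => (y i : ℝ)))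
    (x (Fin.last t) : EuclideanSpace ℝ (Fin d)))

/-- The clipped strategies with regularization parameter in `[lamMin, ∞]` and shift in the unit
ball, with the weight vector `w₀ + (XᵀX + lam I)⁻¹ XᵀY`. -/
def rlsClass {d : ℕ} (X : Set (EuclideanSpace ℝ (Fin d))) (lamMin : ℝ) :
    Set (SupStrategy X Outcome) :=
  {s | ∃ w₀ : EuclideanSpace ℝ (Fin d), ‖w₀‖ ≤ 1 ∧
    ((∃ lam : ℝ, lamMin ≤ lam ∧ s = rlsStrategy X lam w₀) ∨ s = staticStrategy X w₀)}

/-- `s` is a clipped strategy that predicts with a minimizer of the regularized least squares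
objective on the data of all previous rounds (the minimizer is unique when `0 < lam`). -/
def IsRlsMinimizing {d : ℕ} (X : Set (EuclideanSpace ℝ (Fin d))) (lam : ℝ)
    (w₀ : EuclideanSpace ℝ (Fin d)) (s : SupStrategy X Outcome) : Prop :=
  ∀ (t : ℕ) (x : Fin (t + 1) → X) (y : Fin t → Outcome), ∃ w : EuclideanSpace ℝ (Fin d),
    IsMinOn (rlsObjective lam w₀ (fun i : Fin t => (x i.castSucc : EuclideanSpace ℝ (Fin d)))
      (fun i => (y i : ℝ))) Set.univ w ∧
    s t x y = clip (inner ℝ w (x (Fin.last t) : EuclideanSpace ℝ (Fin d)))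

/-- The clipped strategies with regularization parameter in `[lamMin, ∞]` and shift in the unit
ball, with the weight vector that minimizes the regularized least squares objective. -/
def rlsArgminClass {d : ℕ} (X : Set (EuclideanSpace ℝ (Fin d))) (lamMin : ℝ) :
    Set (SupStrategy X Outcome) :=
  {s | ∃ w₀ : EuclideanSpace ℝ (Fin d), ‖w₀‖ ≤ 1 ∧
    ((∃ lam : ℝ, lamMin ≤ lam ∧ IsRlsMinimizing X lam w₀ s) ∨ s = staticStrategy X w₀)}

end

/-! The learner runs exponential weights with learning rate $1/8$, the rate at which the square loss
on $[-1,1]$ is exp-concave. Predicting the posterior mean keeps the loss below $-8$ times the log of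
the mixture $\int e^{-L_\theta/8}\,d\mu(\theta)$, up to normalization, so it suffices to find a
prior whose mixture is not much smaller than $e^{-L_s/8}$ for each competitor $s$
(`supValue_le_of_mixture`).

Put $\mu=1/\lambda$, so that $\lambda=\infty$ becomes $\mu=0$. With $R_\mu=(1+\mu X^{\mathsf
T}X)^{-1}$ and $m=X^{\mathsf T}Y$, the weights are $w_0+\mu R_\mu m$ in (a) and $R_\mu(w_0+\mu m)$
in (b). Both predictions are thus clipped affine functions of $w_0$, with feature $x_t$ or $R_\mu
x_t$ of norm at most one, and are $2t$-Lipschitz in $\mu$ before clipping. Both classes fall under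
`supValue_le_of_affineStrategy`.

The prior is a uniform grid of step $T^{-2}$ in $\mu$ times a Gaussian in $w$. The grid costs $8\log
N$, with $N$ about $T^2/\lambda_{\min}$, plus $O(1)$ for rounding. The Gaussian costs $O(\sqrt T)$
in every dimension: the clipped loss is semiconcave, so moving from $w_0$ to $w_0+v$ adds at most a
linear form, which averages to zero, and squares $\langle z_t,v\rangle^2$, whose Gaussian averages
depend only on $\|z_t\|$ (`exp_le_integral_exp_mul_gaussian`). No covering of the ball is needed. -/

/-! ### Exponential weights for the square loss. -/

lemma concaveOn_exp_neg_sq_div_eight :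
    ConcaveOn ℝ (Set.Icc (-2 : ℝ) 2) fun z => Real.exp (-z ^ 2 / 8) := by
  have h1 : ∀ z : ℝ, HasDerivAt (fun z : ℝ => Real.exp (-z ^ 2 / 8))
      (-(z / 4) * Real.exp (-z ^ 2 / 8)) z := by
    intro z
    have h : HasDerivAt (fun z : ℝ => -z ^ 2 / 8) (-(z / 4)) z := by
      refine (((hasDerivAt_pow 2 z).fun_neg).div_const 8).congr_deriv ?_
      push_cast; ring
    exact h.exp.congr_deriv (mul_comm _ _)
  have h2 : ∀ z : ℝ, HasDerivAt (fun z : ℝ => -(z / 4) * Real.exp (-z ^ 2 / 8))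
      ((z ^ 2 / 16 - 1 / 4) * Real.exp (-z ^ 2 / 8)) z := by
    intro z
    refine ((((hasDerivAt_id' z).div_const 4).fun_neg).fun_mul (h1 z)).congr_deriv ?_
    ring
  refine concaveOn_of_deriv2_nonpos (convex_Icc _ _) (by fun_prop)
    (fun z _ => (h1 z).differentiableAt.differentiableWithinAt) ?_ ?_
  · rw [funext fun z => (h1 z).deriv]
    exact fun z _ => (h2 z).differentiableAt.differentiableWithinAt
  · intro z hz
    rw [interior_Icc] at hz
    simp only [Function.iterate_succ, Function.iterate_zero, Function.comp_apply, id]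
    rw [funext fun z => (h1 z).deriv, (h2 z).deriv]
    -- The factor $(z^2-4)/16$ is nonpositive exactly for $|z|\le 2$: this is what fixes the rate
    -- $1/8$.
    exact mul_nonpos_of_nonpos_of_nonneg (by nlinarith [hz.1, hz.2]) (Real.exp_pos _).le

lemma squareLoss_nonneg (p y : Outcome) : 0 ≤ squareLoss p y := sq_nonneg _

lemma squareLoss_le_four (p y : Outcome) : squareLoss p y ≤ 4 := by
  have := p.2.1; have := p.2.2; have := y.2.1; have := y.2.2
  unfold squareLoss; nlinarith

lemma strategyLoss_squareLoss_nonneg {X : Type*} (s : SupStrategy X Outcome) {n : ℕ}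
    (x : Fin n → X) (y : Fin n → Outcome) : 0 ≤ strategyLoss squareLoss s x y :=
  Finset.sum_nonneg fun _ _ => squareLoss_nonneg _ _

lemma strategyLoss_squareLoss_le {X : Type*} (s : SupStrategy X Outcome) {n : ℕ}
    (x : Fin n → X) (y : Fin n → Outcome) : strategyLoss squareLoss s x y ≤ 4 * n := by
  refine (Finset.sum_le_card_nsmul _ _ 4 fun _ _ => squareLoss_le_four _ _).trans ?_
  simp [mul_comm]

lemma strategyLoss_snoc {X Y : Type*} (loss : Y → Y → ℝ) (s : SupStrategy X Y) {n : ℕ}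
    (x : Fin n → X) (y : Fin n → Y) (a : X) (b : Y) :
    strategyLoss loss s (Fin.snoc (α := fun _ => X) x a) (Fin.snoc (α := fun _ => Y) y b) =
      strategyLoss loss s x y + loss (s n (Fin.snoc (α := fun _ => X) x a) y) b := by
  unfold strategyLoss
  rw [Fin.sum_univ_castSucc]
  congr 1
  · refine Finset.sum_congr rfl fun t _ => ?_
    congr 2
    · funext i
      exact Fin.snoc_castSucc (α := fun _ => X) (i := Fin.castLE t.isLt i) a x
    · funext i
      exact Fin.snoc_castSucc (α := fun _ => Y) (i := Fin.castLE t.isLt.le i) b y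
    · exact Fin.snoc_castSucc (α := fun _ => Y) (i := t) b y
  · congr 2
    · funext i
      exact Fin.snoc_castSucc (α := fun _ => Y) (i := i) b y
    · exact Fin.snoc_last (α := fun _ => Y) b y

lemma measurable_strategyLoss {X Θ : Type*} [MeasurableSpace Θ] {F : Θ → SupStrategy X Outcome}
    (hF : ∀ t x y, Measurable fun θ => F θ t x y) {n : ℕ} (x : Fin n → X) (y : Fin n → Outcome) :
    Measurable fun θ => strategyLoss squareLoss (F θ) x y := by
  unfold strategyLoss squareLoss
  refine Finset.measurable_sum _ fun t _ => ?_
  exact ((measurable_subtype_coe.comp (hF _ _ _)).sub_const _).pow_const 2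

/-- An unbounded real supremum has the default value $0$, hence the condition `C ≤ 0`. The next
lemma has it for the same reason: a non-integrable function has integral $0$. -/
lemma le_iSup_of_forall_le {ι : Type*} [Nonempty ι] {f : ι → ℝ} {C : ℝ} (hC : C ≤ 0)
    (hf : ∀ i, C ≤ f i) : C ≤ ⨆ i, f i := by
  by_cases hb : BddAbove (Set.range f)
  · exact (hf (Classical.arbitrary ι)).trans (le_ciSup hb _)
  · rwa [Real.iSup_of_not_bddAbove hb]

lemma le_integral_of_forall_le {Ω : Type*} [MeasurableSpace Ω] (q : Measure Ω)
    [IsProbabilityMeasure q] {f : Ω → ℝ} {C : ℝ} (hC : C ≤ 0) (hf : ∀ i, C ≤ f i) :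
    C ≤ ∫ r, f r ∂q := by
  by_cases hi : Integrable f q
  · calc C = ∫ _, C ∂q := by simp
      _ ≤ ∫ r, f r ∂q := integral_mono (integrable_const _) hi hf
  · rwa [integral_undef hi]

instance : Nonempty Outcome := ⟨⟨0, by simp⟩⟩

instance : Nonempty (ProbabilityMeasure Outcome) :=
  ⟨⟨Measure.dirac (Classical.arbitrary _), Measure.dirac.isProbabilityMeasure⟩⟩

/-- Every value of the game is bounded below, whatever the integrability of the integrands. -/
lemma supValueFrom_ge {X : Type*} [Nonempty X] {S : Set (SupStrategy X Outcome)}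
    (hS : S.Nonempty) (k : ℕ) {n : ℕ} (x : Fin n → X) (p y : Fin n → Outcome) :
    -(4 * ((n + k : ℕ) : ℝ)) ≤ supValueFrom squareLoss S k x p y := by
  induction k generalizing n with
  | zero =>
    obtain ⟨s, hs⟩ := hS
    have h1 : ⨅ s : S, strategyLoss squareLoss s.1 x y ≤ 4 * n :=
      (ciInf_le ⟨0, by rintro _ ⟨s, rfl⟩; exact strategyLoss_squareLoss_nonneg _ _ _⟩
        (⟨s, hs⟩ : S)).trans (strategyLoss_squareLoss_le _ _ _)
    have h2 : 0 ≤ ∑ t : Fin n, squareLoss (p t) (y t) :=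
      Finset.sum_nonneg fun _ _ => squareLoss_nonneg _ _
    simp only [supValueFrom, supRegret, add_zero]
    linarith
  | succ k ih =>
    have hneg : -(4 * ((n + 1 + k : ℕ) : ℝ)) ≤ 0 := by
      have : (0 : ℝ) ≤ ((n + 1 + k : ℕ) : ℝ) := Nat.cast_nonneg _
      linarith
    rw [supValueFrom, ← add_assoc, add_right_comm]
    exact le_iSup_of_forall_le hneg fun a => le_ciInf fun q => le_iSup_of_forall_le hneg fun b =>
      le_integral_of_forall_le _ hneg fun r => ih _ _ _

lemma integral_withDensity_ofReal {Ω : Type*} [MeasurableSpace Ω] {μ : Measure Ω} {f : Ω → ℝ}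
    (hf : Measurable f) (hf0 : ∀ ω, 0 ≤ f ω) (g : Ω → ℝ) :
    ∫ ω, g ω ∂μ.withDensity (fun ω => ENNReal.ofReal (f ω)) = ∫ ω, g ω * f ω ∂μ := by
  rw [integral_withDensity_eq_integral_toReal_smul (by fun_prop) (by simp)]
  simp [ENNReal.toReal_ofReal (hf0 _), mul_comm]

/-- One step of the exponentially weighted average forecaster for the square loss. -/
lemma exists_prediction_of_mixture {Θ : Type*} [MeasurableSpace Θ] (μ : Measure Θ)
    [IsFiniteMeasure μ] (hμ : μ ≠ 0) (W : Θ → ℝ) (hW : Measurable W) (hW0 : ∀ θ, 0 ≤ W θ)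
    (f : Θ → Outcome) (hf : Measurable f) :
    ∃ p : Outcome, ∀ y : Outcome,
      ∫ θ, Real.exp (-(W θ + squareLoss (f θ) y) / 8) ∂μ ≤
        Real.exp (-squareLoss p y / 8) * ∫ θ, Real.exp (-W θ / 8) ∂μ := by
  set E : Θ → ℝ := fun θ => Real.exp (-W θ / 8)
  have hEm : Measurable E := by fun_prop
  have hE1 : ∀ θ, E θ ≤ 1 := fun θ => Real.exp_le_one_iff.2 (by linarith [hW0 θ])
  have hEi : Integrable E μ := Integrable.of_bound hEm.aestronglyMeasurable 1
    (.of_forall fun θ => by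
      rw [Real.norm_of_nonneg (Real.exp_pos _).le]; exact hE1 θ)
  set ν : Measure Θ := μ.withDensity fun θ => ENNReal.ofReal (E θ)
  have : IsFiniteMeasure ν := isFiniteMeasure_withDensity_ofReal hEi.2
  have hν : ∀ g : Θ → ℝ, ∫ θ, g θ ∂ν = ∫ θ, g θ * E θ ∂μ :=
    integral_withDensity_ofReal hEm fun θ => (Real.exp_pos _).le
  have hZ : 0 < ∫ θ, E θ ∂μ := by
    have : NeZero μ := ⟨hμ⟩
    exact integral_exp_pos hEi
  have hν1 : ν.real Set.univ = ∫ θ, E θ ∂μ := by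
    have := hν fun _ => 1
    simpa using this
  have : NeZero ν := ⟨fun h0 => by rw [h0] at hν1; simp at hν1; linarith⟩
  have hfi : Integrable (fun θ => (f θ : ℝ)) ν :=
    Integrable.of_bound (measurable_subtype_coe.comp hf).aestronglyMeasurable 1
      (.of_forall fun θ => abs_le.2 (f θ).2)
  have hp : (⨍ θ, (f θ : ℝ) ∂ν) ∈ Set.Icc (-1 : ℝ) 1 :=
    (convex_Icc _ _).average_mem isClosed_Icc (.of_forall fun θ => (f θ).2) hfi
  -- The prediction is the posterior mean; Jensen for the concave function $e^{-z^2/8}$ then gives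
  -- the bound for every outcome at once.
  refine ⟨⟨_, hp⟩, fun y => ?_⟩
  have hj := concaveOn_exp_neg_sq_div_eight.le_map_average (μ := ν)
    (f := fun θ => (f θ : ℝ) - y) (by fun_prop) isClosed_Icc
    (.of_forall fun θ => ⟨by linarith [(f θ).2.1, y.2.2], by linarith [(f θ).2.2, y.2.1]⟩)
    (hfi.sub (integrable_const _))
    (Integrable.of_bound (C := 1) (by
      refine Measurable.aestronglyMeasurable ?_
      have := measurable_subtype_coe.comp hf
      simp only [Function.comp_def] at this ⊢
      fun_prop)
      (.of_forall fun θ => by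
        rw [Function.comp_apply, Real.norm_of_nonneg (Real.exp_pos _).le]
        exact Real.exp_le_one_iff.2 (by nlinarith [sq_nonneg ((f θ : ℝ) - y)])))
  have hav : ⨍ θ, ((f θ : ℝ) - y) ∂ν = (⨍ θ, (f θ : ℝ) ∂ν) - y := by
    rw [average_eq, average_eq, integral_sub hfi (integrable_const _), integral_const, smul_sub]
    congr 1
    rw [smul_smul, inv_mul_cancel₀ (by rw [hν1]; exact hZ.ne'), one_smul]
  rw [hav, average_eq, hν1, hν, smul_eq_mul, inv_mul_le_iff₀ hZ, mul_comm] at hj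
  refine le_trans (le_of_eq ?_) hj
  refine integral_congr_ae (.of_forall fun θ => ?_)
  simp only [E, squareLoss, ← Real.exp_add]
  congr 1; ring

/-- If mixing the strategies `F θ` with weights `μ` costs at most `B` compared with every strategy
in `S`, the minimax regret against `S` is at most `B`. -/
theorem supValue_le_of_mixture {X Θ : Type*} [Nonempty X] [MeasurableSpace Θ] (μ : Measure Θ)
    [IsFiniteMeasure μ] (hμ : μ ≠ 0) {S : Set (SupStrategy X Outcome)} (hS : S.Nonempty)
    (F : Θ → SupStrategy X Outcome) (hF : ∀ t x y, Measurable fun θ => F θ t x y) (T : ℕ) (B : ℝ)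
    (h : ∀ s ∈ S, ∀ (x : Fin T → X) (y : Fin T → Outcome),
      μ.real Set.univ * Real.exp (-(strategyLoss squareLoss s x y + B) / 8) ≤
        ∫ θ, Real.exp (-strategyLoss squareLoss (F θ) x y / 8) ∂μ) :
    supValue squareLoss S T ≤ B := by
  have : NeZero μ := ⟨hμ⟩
  have hm : 0 < μ.real Set.univ := measureReal_univ_pos
  have hZ : ∀ {n : ℕ} (x : Fin n → X) (y : Fin n → Outcome),
      0 < ∫ θ, Real.exp (-strategyLoss squareLoss (F θ) x y / 8) ∂μ := by
    intro n x y
    refine integral_exp_pos (Integrable.of_bound (C := 1) ?_ (.of_forall fun θ => ?_))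
    · have := measurable_strategyLoss hF x y
      exact Measurable.aestronglyMeasurable (by fun_prop)
    · rw [Real.norm_of_nonneg (Real.exp_pos _).le]
      exact Real.exp_le_one_iff.2 (by linarith [strategyLoss_squareLoss_nonneg (F θ) x y])
  -- Backward induction on the potential: loss so far plus $8\log$ of the normalized mixture, plus
  -- `B`.
  have key : ∀ (k n : ℕ), n + k = T → ∀ (x : Fin n → X) (p y : Fin n → Outcome),
      supValueFrom squareLoss S k x p y ≤ (∑ t, squareLoss (p t) (y t)) +
        8 * Real.log (∫ θ, Real.exp (-strategyLoss squareLoss (F θ) x y / 8) ∂μ) -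
        8 * Real.log (μ.real Set.univ) + B := by
    intro k
    induction k with
    | zero =>
      rintro n rfl x p y
      have : Nonempty S := hS.to_subtype
      have h1 : 8 * Real.log (μ.real Set.univ) -
          8 * Real.log (∫ θ, Real.exp (-strategyLoss squareLoss (F θ) x y / 8) ∂μ) - B ≤
            ⨅ s : S, strategyLoss squareLoss s.1 x y := by
        refine le_ciInf fun s => ?_
        have h2 := Real.log_le_log (mul_pos hm (Real.exp_pos _)) (h s.1 s.2 x y)
        rw [Real.log_mul hm.ne' (Real.exp_pos _).ne', Real.log_exp] at h2
        linarith
      simp only [supValueFrom, supRegret]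
      linarith
    | succ k ih =>
      intro n hn x p y
      rw [supValueFrom]
      refine ciSup_le fun a => ?_
      obtain ⟨r, hr⟩ := exists_prediction_of_mixture μ hμ
        (fun θ => strategyLoss squareLoss (F θ) x y) (measurable_strategyLoss hF x y)
        (fun θ => strategyLoss_squareLoss_nonneg _ _ _)
        (fun θ => F θ n (Fin.snoc (α := fun _ => X) x a) y) (hF _ _ _)
      have hneg : -(4 * ((n + 1 + k : ℕ) : ℝ)) ≤ 0 := by
        have : (0 : ℝ) ≤ ((n + 1 + k : ℕ) : ℝ) := Nat.cast_nonneg _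
        linarith
      -- The learner plays a point mass, so the expectation is an evaluation and measurability of
      -- the continuation value is not needed. The lower bound makes the infimum genuine.
      refine (ciInf_le ⟨-(4 * ((n + 1 + k : ℕ) : ℝ)), ?_⟩
        (⟨Measure.dirac r, Measure.dirac.isProbabilityMeasure⟩ :
          ProbabilityMeasure Outcome)).trans (ciSup_le fun b => ?_)
      · rintro _ ⟨q, rfl⟩
        refine le_iSup_of_forall_le hneg fun b => ?_
        exact @le_integral_of_forall_le _ _ _ q.2 _ _ hneg fun r => supValueFrom_ge hS _ _ _ _
      · rw [ProbabilityMeasure.coe_mk, integral_dirac]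
        refine (ih (n + 1) (by omega) _ _ _).trans ?_
        have h1 := Real.log_le_log (hZ (Fin.snoc (α := fun _ => X) x a)
          (Fin.snoc (α := fun _ => Outcome) y b)) (by
            simp only [strategyLoss_snoc]; exact hr b)
        rw [Real.log_mul (Real.exp_pos _).ne' (hZ x y).ne', Real.log_exp] at h1
        rw [Fin.sum_univ_castSucc]
        simp only [Fin.snoc_castSucc, Fin.snoc_last]
        linarith
  have h0 := key T 0 (zero_add T) Fin.elim0 Fin.elim0 Fin.elim0
  simpa [supValue, strategyLoss] using h0

/-! ### Dimension-free Gaussian estimates. -/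

section Gaussian

variable {E : Type*} [NormedAddCommGroup E] [InnerProductSpace ℝ E]

/-- Completing the square; it reduces exponential moments to translation invariance of Lebesgue
measure. -/
lemma exp_neg_mul_sq_norm_sub {b : ℝ} (hb : 0 < b) (z v : E) :
    Real.exp (-b * ‖v - (2 * b)⁻¹ • z‖ ^ 2) =
      Real.exp (inner ℝ z v) * Real.exp (-b * ‖v‖ ^ 2) * Real.exp (-(‖z‖ ^ 2 / (4 * b))) := by
  rw [← Real.exp_add, ← Real.exp_add, norm_sub_sq_real, norm_smul, inner_smul_right,
    real_inner_comm, Real.norm_of_nonneg (by positivity)]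
  congr 1
  field_simp
  ring

lemma sq_div_two_le_exp_add_exp_neg (x : ℝ) : x ^ 2 / 2 ≤ Real.exp x + Real.exp (-x) - 2 := by
  rcases le_total 0 x with h | h
  · linarith [Real.quadratic_le_exp_of_nonneg h, Real.add_one_le_exp (-x)]
  · have := Real.quadratic_le_exp_of_nonneg (neg_nonneg.2 h)
    rw [neg_sq] at this
    linarith [Real.add_one_le_exp x]

/-- Second moments are controlled by exponential moments at $\pm z$, which avoids computing a
covariance. -/
lemma inner_sq_mul_gaussian_le {b : ℝ} (z v : E) :
    (inner ℝ z v) ^ 2 * Real.exp (-b * ‖v‖ ^ 2) ≤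
      2 * (Real.exp (inner ℝ z v) * Real.exp (-b * ‖v‖ ^ 2) +
      Real.exp (inner ℝ (-z) v) * Real.exp (-b * ‖v‖ ^ 2) - 2 * Real.exp (-b * ‖v‖ ^ 2)) := by
  have h := sq_div_two_le_exp_add_exp_neg (inner ℝ z v : ℝ)
  rw [inner_neg_left]
  nlinarith [Real.exp_pos (-b * ‖v‖ ^ 2)]

variable [FiniteDimensional ℝ E] [MeasurableSpace E] [BorelSpace E]

lemma integrable_exp_neg_mul_sq_norm {b : ℝ} (hb : 0 < b) :
    Integrable fun v : E => Real.exp (-b * ‖v‖ ^ 2) := by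
  have := GaussianFourier.integrable_cexp_neg_mul_sq_norm_add (V := E) (b := (b : ℂ)) (by simpa) 0 0
  refine this.re.congr (.of_forall fun v => ?_)
  simp only [zero_mul, add_zero]
  rw [← Complex.ofReal_pow, ← Complex.ofReal_neg, ← Complex.ofReal_mul, ← Complex.ofReal_exp]
  exact Complex.ofReal_re _

lemma integrable_exp_inner_mul_gaussian {b : ℝ} (hb : 0 < b) (z : E) :
    Integrable fun v : E => Real.exp (inner ℝ z v) * Real.exp (-b * ‖v‖ ^ 2) := by
  have := ((integrable_exp_neg_mul_sq_norm (E := E) hb).comp_sub_right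
    ((2 * b)⁻¹ • z)).mul_const (Real.exp (‖z‖ ^ 2 / (4 * b)))
  refine this.congr (.of_forall fun v => ?_)
  simp only
  rw [exp_neg_mul_sq_norm_sub hb, mul_assoc, ← Real.exp_add (-(‖z‖ ^ 2 / (4 * b))), neg_add_cancel,
    Real.exp_zero, mul_one]

lemma integral_exp_inner_mul_gaussian {b : ℝ} (hb : 0 < b) (z : E) :
    ∫ v : E, Real.exp (inner ℝ z v) * Real.exp (-b * ‖v‖ ^ 2) =
      Real.exp (‖z‖ ^ 2 / (4 * b)) * ∫ v : E, Real.exp (-b * ‖v‖ ^ 2) := by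
  rw [← integral_sub_right_eq_self (fun v : E => Real.exp (-b * ‖v‖ ^ 2)) ((2 * b)⁻¹ • z),
    ← integral_const_mul]
  refine integral_congr_ae (.of_forall fun v => ?_)
  simp only
  rw [exp_neg_mul_sq_norm_sub hb, mul_comm (Real.exp (‖z‖ ^ 2 / (4 * b))), mul_assoc,
    ← Real.exp_add (-(‖z‖ ^ 2 / (4 * b))), neg_add_cancel, Real.exp_zero, mul_one]

lemma integrable_inner_sq_mul_gaussian {b : ℝ} (hb : 0 < b) (z : E) :
    Integrable fun v : E => (inner ℝ z v) ^ 2 * Real.exp (-b * ‖v‖ ^ 2) := by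
  refine Integrable.mono' ((((integrable_exp_inner_mul_gaussian hb z).add
    (integrable_exp_inner_mul_gaussian hb (-z))).sub
    ((integrable_exp_neg_mul_sq_norm hb).const_mul 2)).const_mul 2) ?_ (.of_forall fun v => ?_)
  · exact Continuous.aestronglyMeasurable (by fun_prop)
  · rw [Real.norm_of_nonneg (by positivity)]
    exact inner_sq_mul_gaussian_le z v

lemma integrable_inner_mul_gaussian {b : ℝ} (hb : 0 < b) (z : E) :
    Integrable fun v : E => (inner ℝ z v) * Real.exp (-b * ‖v‖ ^ 2) := by
  refine Integrable.mono' ((integrable_inner_sq_mul_gaussian hb z).add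
    (integrable_exp_neg_mul_sq_norm hb)) ?_ (.of_forall fun v => ?_)
  · exact Continuous.aestronglyMeasurable (by fun_prop)
  · rw [norm_mul, Real.norm_of_nonneg (Real.exp_pos _).le, Real.norm_eq_abs, Pi.add_apply]
    nlinarith [Real.exp_pos (-b * ‖v‖ ^ 2), sq_nonneg (|(inner ℝ z v : ℝ)| - 1),
      sq_abs (inner ℝ z v : ℝ), abs_nonneg (inner ℝ z v : ℝ)]

lemma integral_inner_mul_gaussian (b : ℝ) (z : E) :
    ∫ v : E, (inner ℝ z v) * Real.exp (-b * ‖v‖ ^ 2) = 0 := by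
  have := integral_neg_eq_self (fun v : E => (inner ℝ z v) * Real.exp (-b * ‖v‖ ^ 2)) volume
  simp only [inner_neg_right, norm_neg, neg_mul, integral_neg] at this ⊢
  linarith

/-- The second moments of a Gaussian density, up to a constant factor. -/
lemma integral_inner_sq_mul_gaussian_le {b : ℝ} (hb : 0 < b) (z : E) (hz : ‖z‖ ≤ 1) :
    ∫ v : E, (inner ℝ z v) ^ 2 * Real.exp (-b * ‖v‖ ^ 2) ≤
      2 / b * ∫ v : E, Real.exp (-b * ‖v‖ ^ 2) := by
  -- At this scale the exponential moment is at most $e\le 3$ times the total mass, so $4b$ times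
  -- the second moment is at most $2(3+3-2)=8$ times the mass.
  set c : ℝ := 2 * Real.sqrt b
  have hc2 : c ^ 2 = 4 * b := by simp only [c]; rw [mul_pow, Real.sq_sqrt hb.le]; norm_num
  have hG : 0 ≤ ∫ v : E, Real.exp (-b * ‖v‖ ^ 2) := integral_nonneg fun v => (Real.exp_pos _).le
  have hcz : ‖c • z‖ ^ 2 / (4 * b) ≤ 1 := by
    rw [norm_smul, mul_pow, Real.norm_eq_abs, sq_abs, hc2, div_le_one (by positivity)]
    have : ‖z‖ ^ 2 ≤ 1 := by nlinarith [norm_nonneg z]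
    nlinarith
  have i1 := integrable_exp_inner_mul_gaussian hb (c • z)
  have i2 := integrable_exp_inner_mul_gaussian hb (-(c • z))
  have i3 := (integrable_exp_neg_mul_sq_norm (E := E) hb).const_mul 2
  have h1 := integral_mono (integrable_inner_sq_mul_gaussian hb (c • z))
    (((i1.add i2).sub i3).const_mul 2) (inner_sq_mul_gaussian_le (c • z))
  simp only [Pi.add_apply, Pi.sub_apply] at h1
  have i12 : Integrable fun v : E => Real.exp (inner ℝ (c • z) v) * Real.exp (-b * ‖v‖ ^ 2) +
      Real.exp (inner ℝ (-(c • z)) v) * Real.exp (-b * ‖v‖ ^ 2) := i1.add i2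
  rw [integral_const_mul, integral_sub i12 i3, integral_add i1 i2,
    integral_exp_inner_mul_gaussian hb, integral_exp_inner_mul_gaussian hb, integral_const_mul,
    norm_neg] at h1
  have h2 : Real.exp (‖c • z‖ ^ 2 / (4 * b)) ≤ 3 :=
    (Real.exp_le_exp.2 hcz).trans (by linarith [Real.exp_one_lt_d9])
  simp only [real_inner_smul_left, mul_pow, hc2, mul_assoc, integral_const_mul] at h1
  rw [div_mul_eq_mul_div, le_div_iff₀ hb]
  nlinarith

/-- Gaussian smoothing of the loss: if `L (w₀ + v)` exceeds `L w₀` by at most a linear form plus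
`n` squares of linear forms of norm at most one, then the exponential of `-L / 8`, averaged with
the density `exp (-b ‖w‖²)`, is not much smaller than its value at `w₀`. -/
lemma exp_le_integral_exp_mul_gaussian {b : ℝ} (hb : 0 < b) {n : ℕ} (L : E → ℝ)
    (hL : Measurable L) (hL0 : ∀ w, 0 ≤ L w) (w₀ g : E) (z : Fin n → E) (hz : ∀ i, ‖z i‖ ≤ 1)
    (h : ∀ v, L (w₀ + v) ≤ L w₀ + inner ℝ g v + ∑ i, (inner ℝ (z i) v) ^ 2) :
    Real.exp (-(L w₀ + 8 * b * ‖w₀‖ ^ 2 + 2 * n / b) / 8) * ∫ v : E, Real.exp (-b * ‖v‖ ^ 2) ≤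
      ∫ w : E, Real.exp (-L w / 8) * Real.exp (-b * ‖w‖ ^ 2) := by
  rw [← integral_add_left_eq_self (fun w : E => Real.exp (-L w / 8) * Real.exp (-b * ‖w‖ ^ 2)) w₀]
  set A : ℝ := Real.exp (-(L w₀ + 8 * b * ‖w₀‖ ^ 2 + 2 * n / b) / 8)
  -- `u` collects all terms linear in `v`: the slope of `L` and the cross term of $\|w_0+v\|^2$.
  -- They integrate to zero by symmetry.
  set u : E := (8 : ℝ)⁻¹ • g + (2 * b) • w₀
  have hpt : ∀ v : E, A * ((1 + 2 * n / b / 8) * Real.exp (-b * ‖v‖ ^ 2) -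
      inner ℝ u v * Real.exp (-b * ‖v‖ ^ 2) -
      (∑ i, (inner ℝ (z i) v) ^ 2 * Real.exp (-b * ‖v‖ ^ 2)) / 8) ≤
      Real.exp (-L (w₀ + v) / 8) * Real.exp (-b * ‖w₀ + v‖ ^ 2) := by
    intro v
    -- Linearizing the exponential suffices: the constant $2n/(8b)$ offsets the average of the
    -- squares, so the integrated right side is at least the Gaussian mass.
    have h1 := Real.add_one_le_exp
      (2 * n / b / 8 - inner ℝ u v - (∑ i, (inner ℝ (z i) v) ^ 2) / 8)
    rw [← Finset.sum_mul]
    calc _ = A * Real.exp (-b * ‖v‖ ^ 2) *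
          (2 * n / b / 8 - inner ℝ u v - (∑ i, (inner ℝ (z i) v) ^ 2) / 8 + 1) := by ring
      _ ≤ A * Real.exp (-b * ‖v‖ ^ 2) *
          Real.exp (2 * n / b / 8 - inner ℝ u v - (∑ i, (inner ℝ (z i) v) ^ 2) / 8) := by
        gcongr
      _ ≤ _ := by
        rw [← Real.exp_add, ← Real.exp_add, ← Real.exp_add, Real.exp_le_exp, norm_add_sq_real,
          inner_add_left, real_inner_smul_left, real_inner_smul_left]
        linarith [h v]
  have i1 := (integrable_exp_neg_mul_sq_norm (E := E) hb).const_mul (1 + 2 * n / b / 8)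
  have i2 := integrable_inner_mul_gaussian hb u
  have i3 : Integrable fun v : E =>
      ∑ i, (inner ℝ (z i) v) ^ 2 * Real.exp (-b * ‖v‖ ^ 2) :=
    integrable_finsetSum _ fun i _ => integrable_inner_sq_mul_gaussian hb (z i)
  have i4 : Integrable fun v : E => Real.exp (-L (w₀ + v) / 8) * Real.exp (-b * ‖w₀ + v‖ ^ 2) := by
    refine Integrable.comp_add_left (f := fun w => Real.exp (-L w / 8) * Real.exp (-b * ‖w‖ ^ 2))
      ?_ w₀
    refine (integrable_exp_neg_mul_sq_norm hb).mono'
      (Measurable.aestronglyMeasurable (by fun_prop)) (.of_forall fun w => ?_)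
    rw [Real.norm_of_nonneg (by positivity)]
    exact mul_le_of_le_one_left (Real.exp_pos _).le
      (Real.exp_le_one_iff.2 (by linarith [hL0 w]))
  have hint := integral_mono (((i1.sub i2).sub (i3.div_const 8)).const_mul A) i4 hpt
  refine le_trans ?_ hint
  rw [integral_const_mul]
  refine mul_le_mul_of_nonneg_left ?_ (Real.exp_pos _).le
  rw [integral_sub' (i1.sub i2) (i3.div_const 8), integral_sub' i1 i2, integral_const_mul,
    integral_inner_mul_gaussian, integral_div,
    integral_finsetSum _ fun i _ => integrable_inner_sq_mul_gaussian hb (z i)]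
  have hs : ∑ i, ∫ v : E, (inner ℝ (z i) v) ^ 2 * Real.exp (-b * ‖v‖ ^ 2) ≤
      n * (2 / b * ∫ v : E, Real.exp (-b * ‖v‖ ^ 2)) := by
    refine (Finset.sum_le_card_nsmul _ _ _ fun i _ =>
      integral_inner_sq_mul_gaussian_le hb (z i) (hz i)).trans ?_
    simp
  rw [← mul_assoc, mul_div_assoc', mul_comm (n : ℝ)] at hs
  linarith

end Gaussian

/-! ### Resolvents of positive semidefinite operators. -/

section Resolvent

variable {E : Type*} [NormedAddCommGroup E] [InnerProductSpace ℝ E]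

/-- The resolvent `(1 + μ G)⁻¹`. -/
noncomputable def resolventAt (G : E →ₗ[ℝ] E) (μ : ℝ) : E →ₗ[ℝ] E :=
  Ring.inverse (1 + μ • G : Module.End ℝ E)

variable {G : E →ₗ[ℝ] E} (hG : ∀ v, 0 ≤ inner ℝ (G v) v)
include hG

lemma norm_le_norm_add_smul {μ : ℝ} (hμ : 0 ≤ μ) (v : E) : ‖v‖ ≤ ‖v + μ • G v‖ := by
  have h1 : ‖v‖ ^ 2 ≤ inner ℝ (v + μ • G v) v := by
    rw [inner_add_left, real_inner_self_eq_norm_sq, real_inner_smul_left]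
    nlinarith [mul_nonneg hμ (hG v)]
  have h2 := real_inner_le_norm (v + μ • G v) v
  by_contra! h
  nlinarith [norm_nonneg v, norm_nonneg (v + μ • G v)]

variable [FiniteDimensional ℝ E]

lemma isUnit_one_add_smul {μ : ℝ} (hμ : 0 ≤ μ) : IsUnit (1 + μ • G : Module.End ℝ E) := by
  rw [LinearMap.isUnit_iff_ker_eq_bot, LinearMap.ker_eq_bot']
  intro v hv
  have := norm_le_norm_add_smul hG hμ v
  simp only [LinearMap.add_apply, Module.End.one_apply, LinearMap.smul_apply] at hv
  rw [hv, norm_zero] at this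
  exact norm_le_zero_iff.1 this

lemma resolventAt_add_smul {μ : ℝ} (hμ : 0 ≤ μ) (v : E) :
    resolventAt G μ v + μ • G (resolventAt G μ v) = v :=
  LinearMap.congr_fun (Ring.mul_inverse_cancel _ (isUnit_one_add_smul hG hμ)) v

lemma eq_resolventAt {μ : ℝ} (hμ : 0 ≤ μ) {u v : E} (h : u + μ • G u = v) :
    u = resolventAt G μ v := by
  have := LinearMap.congr_fun (Ring.inverse_mul_cancel _ (isUnit_one_add_smul hG hμ)) u
  rw [← h]
  exact this.symm

lemma norm_resolventAt_le {μ : ℝ} (hμ : 0 ≤ μ) (v : E) : ‖resolventAt G μ v‖ ≤ ‖v‖ := by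
  have := norm_le_norm_add_smul hG hμ (resolventAt G μ v)
  rwa [resolventAt_add_smul hG hμ] at this

lemma inner_resolventAt_comm (hs : G.IsSymmetric) {μ : ℝ} (hμ : 0 ≤ μ) (v w : E) :
    inner ℝ (resolventAt G μ v) w = inner ℝ v (resolventAt G μ w) := by
  conv_lhs => rw [← resolventAt_add_smul hG hμ w]
  conv_rhs => rw [← resolventAt_add_smul hG hμ v]
  rw [inner_add_left, inner_add_right, real_inner_smul_left, real_inner_smul_right, hs]

/-- Resolvent identity $R_\mu-R_\nu=(\nu-\mu)R_\mu G R_\nu$, with both resolvents contractions. -/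
lemma norm_resolventAt_sub_le {μ ν : ℝ} (hμ : 0 ≤ μ) (hν : 0 ≤ ν) {C : ℝ}
    (hC : ∀ v, ‖G v‖ ≤ C * ‖v‖) (hC0 : 0 ≤ C) (v : E) :
    ‖resolventAt G μ v - resolventAt G ν v‖ ≤ |μ - ν| * (C * ‖v‖) := by
  have h : (resolventAt G μ v - resolventAt G ν v) +
      μ • G (resolventAt G μ v - resolventAt G ν v) = (ν - μ) • G (resolventAt G ν v) := by
    have h1 := resolventAt_add_smul hG hμ v
    have h2 := resolventAt_add_smul hG hν v
    rw [map_sub, smul_sub, sub_smul]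
    linear_combination (norm := module) h1 - h2
  rw [eq_resolventAt hG hμ h]
  refine (norm_resolventAt_le hG hμ _).trans ?_
  rw [norm_smul, Real.norm_eq_abs, abs_sub_comm]
  gcongr
  exact (hC _).trans (by gcongr; exact norm_resolventAt_le hG hν v)

/-- Here $\mu R_\mu-\nu R_\nu=(\mu-\nu)R_\mu R_\nu$, so the bound does not involve the size of $G$.
-/
lemma norm_smul_resolventAt_sub_le {μ ν : ℝ} (hμ : 0 ≤ μ) (hν : 0 ≤ ν) (v : E) :
    ‖μ • resolventAt G μ v - ν • resolventAt G ν v‖ ≤ |μ - ν| * ‖v‖ := by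
  have h : (μ • resolventAt G μ v - ν • resolventAt G ν v) +
      μ • G (μ • resolventAt G μ v - ν • resolventAt G ν v) =
        (μ - ν) • resolventAt G ν v := by
    have h1 := resolventAt_add_smul hG hμ v
    have h2 := resolventAt_add_smul hG hν v
    rw [map_sub, map_smul, map_smul]
    linear_combination (norm := module) μ • h1 - μ • h2
  rw [eq_resolventAt hG hμ h]
  refine (norm_resolventAt_le hG hμ _).trans ?_
  rw [norm_smul, Real.norm_eq_abs]
  gcongr
  exact norm_resolventAt_le hG hν v

end Resolvent

/-! ### Gram operators and moment vectors. -/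

section Gram

variable {E : Type*} [NormedAddCommGroup E] [InnerProductSpace ℝ E] {t : ℕ}

/-- The Gram operator `v ↦ ∑ ⟨x_i, v⟩ x_i`. -/
noncomputable def gramOp (x : Fin t → E) : E →ₗ[ℝ] E :=
  ∑ i, (innerₗ E (x i)).smulRight (x i)

lemma gramOp_apply (x : Fin t → E) (v : E) :
    gramOp x v = ∑ i, (inner ℝ (x i) v : ℝ) • x i := by
  simp [gramOp, LinearMap.sum_apply]

lemma inner_gramOp (x : Fin t → E) (v w : E) :
    inner ℝ (gramOp x v) w = ∑ i, (inner ℝ (x i) v * inner ℝ (x i) w : ℝ) := by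
  simp [gramOp_apply, sum_inner, real_inner_smul_left]

lemma inner_gramOp_self_nonneg (x : Fin t → E) (v : E) : 0 ≤ inner ℝ (gramOp x v) v := by
  rw [inner_gramOp]
  exact Finset.sum_nonneg fun i _ => mul_self_nonneg _

lemma gramOp_isSymmetric (x : Fin t → E) : (gramOp x).IsSymmetric := by
  intro v w
  rw [inner_gramOp, real_inner_comm, inner_gramOp]
  simp [mul_comm]

lemma norm_gramOp_le (x : Fin t → E) (hx : ∀ i, ‖x i‖ ≤ 1) (v : E) :
    ‖gramOp x v‖ ≤ t * ‖v‖ := by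
  rw [gramOp_apply]
  refine (norm_sum_le_of_le (f := fun i => (inner ℝ (x i) v : ℝ) • x i) (n := fun _ => ‖v‖) _
    fun i _ => ?_).trans (by simp)
  rw [norm_smul]
  calc _ ≤ ‖x i‖ * ‖v‖ * ‖x i‖ := by gcongr; exact norm_inner_le_norm _ _
    _ ≤ 1 * ‖v‖ * 1 := by gcongr <;> exact hx i
    _ = ‖v‖ := by ring

/-- The vector `∑ y_i x_i`. -/
noncomputable def momentVec (x : Fin t → E) (y : Fin t → ℝ) : E := ∑ i, y i • x i

lemma norm_momentVec_le (x : Fin t → E) (hx : ∀ i, ‖x i‖ ≤ 1) (y : Fin t → ℝ)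
    (hy : ∀ i, |y i| ≤ 1) : ‖momentVec x y‖ ≤ t := by
  refine (norm_sum_le_of_le (f := fun i => y i • x i) (n := fun _ => 1) _
    fun i _ => ?_).trans (by simp)
  rw [norm_smul]
  exact mul_le_one₀ (hy i) (norm_nonneg _) (hx i)

end Gram

/-! ### Both kinds of ridge weights in terms of the resolvent. -/

lemma rlsWeight_eq {d t : ℕ} {lam : ℝ} (hlam : 0 < lam) (w₀ : EuclideanSpace ℝ (Fin d))
    (x : Fin t → EuclideanSpace ℝ (Fin d)) (y : Fin t → ℝ) :
    rlsWeight lam w₀ x y =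
      w₀ + lam⁻¹ • resolventAt (gramOp x) lam⁻¹ (momentVec x y) := by
  set M : Matrix (Fin d) (Fin d) ℝ :=
    (dataMatrix x).transpose * dataMatrix x + lam • (1 : Matrix (Fin d) (Fin d) ℝ)
  set u := (M⁻¹.mulVec ((dataMatrix x).transpose.mulVec y))
  have hM : M.PosDef := by
    refine Matrix.PosDef.posSemidef_add ?_ (Matrix.PosDef.one.smul hlam)
    have := Matrix.posSemidef_conjTranspose_mul_self (dataMatrix x)
    rwa [Matrix.conjTranspose_eq_transpose_of_trivial] at this
  have hu : M.mulVec u = (dataMatrix x).transpose.mulVec y := by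
    simp only [u]
    rw [Matrix.mulVec_mulVec, Matrix.mul_nonsing_inv _ ((Matrix.isUnit_iff_isUnit_det _).1 hM.isUnit),
      Matrix.one_mulVec]
  have hu' : lam • WithLp.toLp 2 u + gramOp x (WithLp.toLp 2 u) = momentVec x y := by
    ext j
    have hj := congrFun hu j
    simp only [M, Matrix.add_mulVec, Matrix.smul_mulVec, Matrix.one_mulVec, Pi.add_apply,
      ← Matrix.mulVec_mulVec] at hj
    simp only [gramOp_apply, momentVec, PiLp.add_apply, PiLp.smul_apply, WithLp.ofLp_sum,
      Finset.sum_apply]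
    simp only [Matrix.mulVec, dotProduct, Matrix.transpose_apply, dataMatrix, Matrix.of_apply] at hj
    simp [PiLp.inner_apply] at hj ⊢
    simp only [mul_comm, add_comm] at hj ⊢
    exact hj
  have h : lam • WithLp.toLp 2 u + lam⁻¹ • gramOp x (lam • WithLp.toLp 2 u) = momentVec x y := by
    rw [map_smul, smul_smul, inv_mul_cancel₀ hlam.ne', one_smul, hu']
  rw [← eq_resolventAt (inner_gramOp_self_nonneg x) (inv_nonneg.2 hlam.le) h, smul_smul,
    inv_mul_cancel₀ hlam.ne', one_smul]
  rfl

lemma eq_of_isMinOn_rlsObjective {d t : ℕ} {lam : ℝ} (hlam : 0 < lam)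
    (w₀ : EuclideanSpace ℝ (Fin d)) (x : Fin t → EuclideanSpace ℝ (Fin d)) (y : Fin t → ℝ)
    {w : EuclideanSpace ℝ (Fin d)} (hw : IsMinOn (rlsObjective lam w₀ x y) Set.univ w) :
    w = resolventAt (gramOp x) lam⁻¹ (w₀ + lam⁻¹ • momentVec x y) := by
  -- `D` is half the gradient of the objective at `w`; it vanishes at a minimizer.
  set D : EuclideanSpace ℝ (Fin d) := lam • (w - w₀) + gramOp x w - momentVec x y
  have hexp : ∀ ε : ℝ, rlsObjective lam w₀ x y (w + ε • D) = rlsObjective lam w₀ x y w +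
      2 * ε * ‖D‖ ^ 2 + ε ^ 2 * (∑ i, (inner ℝ (x i) D : ℝ) ^ 2 + lam * ‖D‖ ^ 2) := by
    intro ε
    have hD : ‖D‖ ^ 2 = lam * inner ℝ (w - w₀) D + ∑ i, (inner ℝ (x i) w * inner ℝ (x i) D : ℝ) -
        ∑ i, (y i * inner ℝ (x i) D : ℝ) := by
      rw [← real_inner_self_eq_norm_sq]
      conv_lhs => rw [show inner ℝ D D = inner ℝ (lam • (w - w₀) + gramOp x w - momentVec x y) D
        from rfl]
      rw [inner_sub_left, inner_add_left, real_inner_smul_left, inner_gramOp, momentVec, sum_inner]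
      simp [real_inner_smul_left]
    have h1 : ‖w + ε • D - w₀‖ ^ 2 = ‖w - w₀‖ ^ 2 + 2 * ε * inner ℝ (w - w₀) D +
        ε ^ 2 * ‖D‖ ^ 2 := by
      rw [add_sub_right_comm, norm_add_sq_real, real_inner_smul_right, norm_smul, mul_pow,
        Real.norm_eq_abs, sq_abs]
      ring
    have h2 : ∑ i, (y i - inner ℝ (x i) (w + ε • D)) ^ 2 = ∑ i, (y i - inner ℝ (x i) w) ^ 2 +
        2 * ε * (∑ i, (inner ℝ (x i) w * inner ℝ (x i) D : ℝ) -
        ∑ i, (y i * inner ℝ (x i) D : ℝ)) + ε ^ 2 * ∑ i, (inner ℝ (x i) D : ℝ) ^ 2 := by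
      rw [← Finset.sum_sub_distrib, Finset.mul_sum, Finset.mul_sum, ← Finset.sum_add_distrib,
        ← Finset.sum_add_distrib]
      refine Finset.sum_congr rfl fun i _ => ?_
      rw [inner_add_right, real_inner_smul_right]
      ring
    simp only [rlsObjective, h1, h2]
    linear_combination -2 * ε * hD
  have hD : D = 0 := by
    set K : ℝ := ∑ i, (inner ℝ (x i) D : ℝ) ^ 2 + lam * ‖D‖ ^ 2
    have hK : 0 ≤ K := add_nonneg (Finset.sum_nonneg fun _ _ => sq_nonneg _) (by positivity)
    by_contra hne
    have hpos : 0 < ‖D‖ ^ 2 := by positivity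
    -- A step short enough that $a^2K\le a\|D\|^2$: moving by $-aD$ changes the objective by
    -- $-2a\|D\|^2+a^2K<0$.
    set a : ℝ := ‖D‖ ^ 2 / (K + 1)
    have ha : 0 < a := by positivity
    have haK : a * K + a = ‖D‖ ^ 2 := by
      have : a * (K + 1) = ‖D‖ ^ 2 := div_mul_cancel₀ _ (by positivity)
      linarith
    have h1 := isMinOn_univ_iff.1 hw (w + (-a) • D)
    rw [hexp] at h1
    nlinarith
  refine eq_resolventAt (inner_gramOp_self_nonneg x) (inv_nonneg.2 hlam.le) ?_
  have h : lam • (w - w₀) + gramOp x w = momentVec x y := sub_eq_zero.1 hD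
  rw [← h, smul_add, smul_smul, inv_mul_cancel₀ hlam.ne', one_smul]
  abel

/-! ### Regularity of the clipped square loss. -/

lemma abs_clip_sub_clip_le (a a' : ℝ) : |((clip a : Outcome) : ℝ) - clip a'| ≤ |a - a'| :=
  Set.abs_projIcc_sub_projIcc _

lemma coe_clip (a : ℝ) : ((clip a : Outcome) : ℝ) = max (-1) (min 1 a) := rfl

lemma squareLoss_clip_le (a a' : ℝ) (y : Outcome) :
    squareLoss (clip a) y ≤ squareLoss (clip a') y + 4 * |a - a'| := by
  have h1 := abs_clip_sub_clip_le a a'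
  have h2 : |((clip a : Outcome) : ℝ) + clip a' - 2 * y| ≤ 4 := by
    have := (clip a).2; have := (clip a').2; have := y.2
    simp only [Set.mem_Icc] at *
    rw [abs_le]; constructor <;> linarith
  have h3 : squareLoss (clip a) y - squareLoss (clip a') y =
      (((clip a : Outcome) : ℝ) - clip a') * ((clip a : Outcome) + clip a' - 2 * y) := by
    unfold squareLoss; ring
  have h4 : squareLoss (clip a) y - squareLoss (clip a') y ≤ |a - a'| * 4 := by
    rw [h3]
    refine (le_abs_self _).trans ?_
    rw [abs_mul]
    gcongr
  linarith

/-- The square loss of a clipped prediction is semiconcave in the prediction, because clipping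
only introduces concave kinks. -/
lemma exists_squareLoss_clip_add_le (a : ℝ) (y : Outcome) : ∃ s : ℝ, ∀ h : ℝ,
    squareLoss (clip (a + h)) y ≤ squareLoss (clip a) y + s * h + h ^ 2 := by
  have hy := y.2
  simp only [Set.mem_Icc] at hy
  unfold squareLoss
  rcases lt_or_ge a (-1) with ha | ha
  · refine ⟨0, fun h => ?_⟩
    rw [coe_clip, coe_clip, min_eq_right (by linarith : a ≤ 1), max_eq_left ha.le]
    rcases le_total (a + h) (-1) with h1 | h1
    · rw [min_eq_right (by linarith), max_eq_left h1]; nlinarith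
    rcases le_total 1 (a + h) with h2 | h2
    · rw [min_eq_left h2, max_eq_right (by norm_num)]; nlinarith
    · rw [min_eq_right h2, max_eq_right h1]; nlinarith
  rcases lt_or_ge 1 a with ha' | ha'
  · refine ⟨0, fun h => ?_⟩
    rw [coe_clip, coe_clip, min_eq_left ha'.le, max_eq_right (by norm_num : (-1 : ℝ) ≤ 1)]
    rcases le_total (a + h) (-1) with h1 | h1
    · rw [min_eq_right (by linarith), max_eq_left h1]; nlinarith
    rcases le_total 1 (a + h) with h2 | h2
    · rw [min_eq_left h2, max_eq_right (by norm_num)]; nlinarith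
    · rw [min_eq_right h2, max_eq_right h1]; nlinarith
  · refine ⟨2 * (a - y), fun h => ?_⟩
    rw [coe_clip, coe_clip, min_eq_right ha', max_eq_right ha]
    rcases le_total (a + h) (-1) with h1 | h1
    · rw [min_eq_right (by linarith), max_eq_left h1]; nlinarith
    rcases le_total 1 (a + h) with h2 | h2
    · rw [min_eq_left h2, max_eq_right (by norm_num)]; nlinarith
    · rw [min_eq_right h2, max_eq_right h1]; nlinarith

/-! ### Regret against clipped affine predictors. -/

/-- The strategies that clip `⟨z, w⟩ + o`, where the feature `z` and the offset `o` depend on the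
history and on a real parameter `μ`. -/
noncomputable def affineStrategy {X E : Type*} [NormedAddCommGroup E] [InnerProductSpace ℝ E]
    (z : (t : ℕ) → (Fin (t + 1) → X) → (Fin t → Outcome) → ℝ → E)
    (o : (t : ℕ) → (Fin (t + 1) → X) → (Fin t → Outcome) → ℝ → ℝ) (μ : ℝ) (w : E) :
    SupStrategy X Outcome :=
  fun t x y => clip (inner ℝ (z t x y μ) w + o t x y μ)

section Affine

variable {X E : Type*} [NormedAddCommGroup E] [InnerProductSpace ℝ E]
  (z : (t : ℕ) → (Fin (t + 1) → X) → (Fin t → Outcome) → ℝ → E)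
  (o : (t : ℕ) → (Fin (t + 1) → X) → (Fin t → Outcome) → ℝ → ℝ)

lemma continuous_affineStrategy (μ : ℝ) {t : ℕ} (x : Fin (t + 1) → X) (y : Fin t → Outcome) :
    Continuous fun w => affineStrategy z o μ w t x y := by
  have : Continuous clip := continuous_projIcc (h := by norm_num)
  unfold affineStrategy
  fun_prop

/-- The data are fixed, so features and offsets do not move with `w`, and the one-round
semiconcavity bounds add up. -/
lemma strategyLoss_affineStrategy_add_le (μ : ℝ) {T : ℕ} (x : Fin T → X) (y : Fin T → Outcome)
    (w₀ : E) : ∃ g : E, ∀ v : E, strategyLoss squareLoss (affineStrategy z o μ (w₀ + v)) x y ≤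
      strategyLoss squareLoss (affineStrategy z o μ w₀) x y + inner ℝ g v +
        ∑ t : Fin T, (inner ℝ (z t (fun i => x (Fin.castLE t.isLt i))
          (fun i => y (Fin.castLE t.isLt.le i)) μ) v) ^ 2 := by
  set ζ : Fin T → E := fun t => z t (fun i => x (Fin.castLE t.isLt i))
          (fun i => y (Fin.castLE t.isLt.le i)) μ
  choose s hs using fun t : Fin T => exists_squareLoss_clip_add_le
    (inner ℝ (ζ t) w₀ + o t (fun i => x (Fin.castLE t.isLt i))
      (fun i => y (Fin.castLE t.isLt.le i)) μ) (y t)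
  refine ⟨∑ t, s t • ζ t, fun v => ?_⟩
  rw [sum_inner, strategyLoss, strategyLoss, ← Finset.sum_add_distrib, ← Finset.sum_add_distrib]
  refine Finset.sum_le_sum fun t _ => ?_
  rw [real_inner_smul_left]
  refine le_trans (le_of_eq ?_) (hs t (inner ℝ (ζ t) v))
  simp only [affineStrategy, ζ, inner_add_right]
  rw [add_right_comm]

variable {z o}

lemma strategyLoss_affineStrategy_le {w : E}
    (hlip : ∀ t x y μ ν, 0 ≤ μ → 0 ≤ ν → |(inner ℝ (z t x y μ) w + o t x y μ) -
      (inner ℝ (z t x y ν) w + o t x y ν)| ≤ 2 * t * |μ - ν|)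
    {μ ν : ℝ} (hμ : 0 ≤ μ) (hν : 0 ≤ ν) {T : ℕ} (x : Fin T → X) (y : Fin T → Outcome) :
    strategyLoss squareLoss (affineStrategy z o μ w) x y ≤
      strategyLoss squareLoss (affineStrategy z o ν w) x y + 8 * T ^ 2 * |μ - ν| := by
  have : 8 * (T : ℝ) ^ 2 * |μ - ν| = ∑ _t : Fin T, 8 * T * |μ - ν| := by
    simp; ring
  rw [this, strategyLoss, strategyLoss, ← Finset.sum_add_distrib]
  refine Finset.sum_le_sum fun t _ => (squareLoss_clip_le _ (inner ℝ (z t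
    (fun i => x (Fin.castLE t.isLt i)) (fun i => y (Fin.castLE t.isLt.le i)) ν) w +
    o t (fun i => x (Fin.castLE t.isLt i)) (fun i => y (Fin.castLE t.isLt.le i)) ν) _).trans ?_
  refine add_le_add le_rfl ?_
  have h1 := hlip t (fun i => x (Fin.castLE t.isLt i))
      (fun i => y (Fin.castLE t.isLt.le i)) μ ν hμ hν
  have h2 : (t : ℝ) ≤ T := by exact_mod_cast t.isLt.le
  have h3 := mul_le_mul_of_nonneg_right h2 (abs_nonneg (μ - ν))
  linarith

/-- Minimax regret against a one-parameter family of clipped affine predictors. -/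
theorem supValue_le_of_affineStrategy [Nonempty X] [FiniteDimensional ℝ E] [MeasurableSpace E]
    [BorelSpace E]
    (hz : ∀ t x y μ, 0 ≤ μ → ‖z t x y μ‖ ≤ 1)
    (hlip : ∀ w, ‖w‖ ≤ 1 → ∀ t x y μ ν, 0 ≤ μ → 0 ≤ ν → |(inner ℝ (z t x y μ) w + o t x y μ) -
      (inner ℝ (z t x y ν) w + o t x y ν)| ≤ 2 * t * |μ - ν|)
    {S : Set (SupStrategy X Outcome)} (hSne : S.Nonempty) {M : ℝ}
    (hS : ∀ s ∈ S, ∃ w μ, ‖w‖ ≤ 1 ∧ 0 ≤ μ ∧ μ ≤ M ∧ s = affineStrategy z o μ w)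
    {T N : ℕ} (hT : 0 < T) (hN : M * T ^ 2 < N) (hN0 : 0 < N) :
    supValue squareLoss S T ≤ 8 * Real.log N + 10 * Real.sqrt T + 8 := by
  have hT' : (0 : ℝ) < T := by exact_mod_cast hT
  -- This makes both costs, $8b\|w\|^2$ for the distance to the origin and $2T/b$ for the spread, of
  -- order $\sqrt T$.
  set b : ℝ := Real.sqrt T
  have hb : 0 < b := Real.sqrt_pos.2 hT'
  have hbb : b * b = T := Real.mul_self_sqrt hT'.le
  have hWm : Measurable fun v : E => Real.exp (-b * ‖v‖ ^ 2) := by fun_prop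
  have hWi := integrable_exp_neg_mul_sq_norm (E := E) hb
  set γ : Measure E := volume.withDensity fun v => ENNReal.ofReal (Real.exp (-b * ‖v‖ ^ 2))
  have : IsFiniteMeasure γ := isFiniteMeasure_withDensity_ofReal hWi.2
  have hγ : ∀ g : E → ℝ, ∫ v, g v ∂γ = ∫ v, g v * Real.exp (-b * ‖v‖ ^ 2) :=
    integral_withDensity_ofReal hWm fun v => (Real.exp_pos _).le
  have hγ1 : γ.real Set.univ = ∫ v : E, Real.exp (-b * ‖v‖ ^ 2) := by
    simpa using hγ fun _ => 1
  have hZ : 0 < ∫ v : E, Real.exp (-b * ‖v‖ ^ 2) := integral_exp_pos hWi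
  set μ : Measure (Fin N × E) := Measure.count.prod γ
  have hμ1 : μ.real Set.univ = N * ∫ v : E, Real.exp (-b * ‖v‖ ^ 2) := by
    rw [← Set.univ_prod_univ, measureReal_prod_prod, hγ1]
    simp [measureReal_def]
  have hN' : (0 : ℝ) < N := by exact_mod_cast hN0
  have hμ0 : μ ≠ 0 := by
    intro h
    rw [h] at hμ1
    simp only [measureReal_zero, Pi.zero_apply] at hμ1
    exact (mul_pos hN' hZ).ne hμ1
  set F : Fin N × E → SupStrategy X Outcome := fun θ => affineStrategy z o (θ.1 / T ^ 2) θ.2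
  have hF : ∀ t x y, Measurable fun θ => F θ t x y := fun t x y =>
    measurable_from_prod_countable_right fun j =>
      (continuous_affineStrategy z o ((j : ℕ) / (T : ℝ) ^ 2) x y).measurable
  refine supValue_le_of_mixture μ hμ0 hSne F hF T _ fun s hs x y => ?_
  obtain ⟨w, ν, hw, hν, hνM, rfl⟩ := hS s hs
  -- Round $\nu$ down to the grid. The error is at most $T^{-2}$, which costs at most $8$ in total
  -- loss.
  have hjN : ⌊ν * T ^ 2⌋₊ < N := by
    rw [Nat.floor_lt (by positivity)]
    exact lt_of_le_of_lt (by gcongr) hN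
  set j : Fin N := ⟨_, hjN⟩
  have hm : Measurable fun θ => strategyLoss squareLoss (F θ) x y := measurable_strategyLoss hF x y
  have hi : Integrable (fun θ => Real.exp (-strategyLoss squareLoss (F θ) x y / 8)) μ := by
    refine Integrable.of_bound (C := 1) (Measurable.aestronglyMeasurable (by fun_prop))
      (.of_forall fun θ => ?_)
    rw [Real.norm_of_nonneg (Real.exp_pos _).le]
    exact Real.exp_le_one_iff.2 (by linarith [strategyLoss_squareLoss_nonneg (F θ) x y])
  -- Only the grid point `j` is kept; the discarded others cost the factor $N$, hence $8\log N$.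
  rw [integral_prod _ hi, integral_count]
  refine le_trans ?_ (Finset.single_le_sum
    (f := fun j => ∫ v, Real.exp (-strategyLoss squareLoss (F (j, v)) x y / 8) ∂γ)
    (fun i _ => integral_nonneg fun v => (Real.exp_pos _).le) (Finset.mem_univ j))
  rw [hγ, hμ1]
  obtain ⟨g, hg⟩ := strategyLoss_affineStrategy_add_le z o ((j : ℕ) / (T : ℝ) ^ 2) x y w
  have hj0 : (0 : ℝ) ≤ (j : ℕ) / (T : ℝ) ^ 2 := by positivity
  refine le_trans ?_ (exp_le_integral_exp_mul_gaussian hb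
    (fun v => strategyLoss squareLoss (F (j, v)) x y) (hm.comp measurable_prodMk_left)
    (fun v => strategyLoss_squareLoss_nonneg _ _ _) w g _ (fun t => hz _ _ _ _ hj0) hg)
  rw [mul_right_comm, mul_comm (N : ℝ)]
  refine mul_le_mul_of_nonneg_right ?_ hZ.le
  rw [← Real.exp_log hN', ← Real.exp_add, Real.exp_le_exp, Real.exp_log hN']
  have h1 := strategyLoss_affineStrategy_le (hlip w hw) hj0 hν x y
  have h2 : 8 * (T : ℝ) ^ 2 * |(j : ℕ) / (T : ℝ) ^ 2 - ν| ≤ 8 := by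
    have h3 : (T : ℝ) ^ 2 * |(j : ℕ) / (T : ℝ) ^ 2 - ν| = |((j : ℕ) : ℝ) - ν * T ^ 2| := by
      rw [← abs_of_pos (show (0 : ℝ) < T ^ 2 by positivity), ← abs_mul, abs_of_pos
        (show (0 : ℝ) < T ^ 2 by positivity)]
      congr 1
      field_simp
    have h4 : |((j : ℕ) : ℝ) - ν * T ^ 2| ≤ 1 := by
      have := Nat.floor_le (show 0 ≤ ν * (T : ℝ) ^ 2 by positivity)
      have := Nat.lt_floor_add_one (ν * (T : ℝ) ^ 2)
      rw [abs_le]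
      constructor <;> simp only [j] <;> linarith
    linarith
  have h3 : 2 * (T : ℝ) / b = 2 * b := by rw [← hbb]; field_simp
  have h4 : 8 * b * ‖w‖ ^ 2 ≤ 8 * b := by
    have : ‖w‖ ^ 2 ≤ 1 := by nlinarith [norm_nonneg w]
    nlinarith
  rw [h3]
  change _ ≤ -(strategyLoss squareLoss (affineStrategy z o ((j : ℕ) / (T : ℝ) ^ 2) w) x y +
    8 * b * ‖w‖ ^ 2 + 2 * b) / 8
  linarith

end Affine

/-! ### From the explicit bound to the rate. -/

/-- A one-point mixture: imitating any single member loses at most $4$ per round. -/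
lemma supValue_squareLoss_le {X : Type*} [Nonempty X] {S : Set (SupStrategy X Outcome)}
    (hS : S.Nonempty) (T : ℕ) : supValue squareLoss S T ≤ 4 * T := by
  obtain ⟨s₀, hs₀⟩ := hS
  refine supValue_le_of_mixture (Measure.dirac ()) (Measure.dirac_ne_zero) ⟨s₀, hs₀⟩ (fun _ => s₀)
    (fun _ _ _ => measurable_const) T _ fun s _ x y => ?_
  simp only [probReal_univ, one_mul, integral_const, smul_eq_mul, Real.exp_le_exp]
  linarith [strategyLoss_squareLoss_nonneg s x y, strategyLoss_squareLoss_le s₀ x y]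

lemma supValue_le_mul_sqrt {X E : Type*} [NormedAddCommGroup E] [InnerProductSpace ℝ E]
    [Nonempty X] [FiniteDimensional ℝ E]
    {z : (t : ℕ) → (Fin (t + 1) → X) → (Fin t → Outcome) → ℝ → E}
    {o : (t : ℕ) → (Fin (t + 1) → X) → (Fin t → Outcome) → ℝ → ℝ}
    (hz : ∀ t x y μ, 0 ≤ μ → ‖z t x y μ‖ ≤ 1)
    (hlip : ∀ w, ‖w‖ ≤ 1 → ∀ t x y μ ν, 0 ≤ μ → 0 ≤ ν → |(inner ℝ (z t x y μ) w + o t x y μ) -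
      (inner ℝ (z t x y ν) w + o t x y ν)| ≤ 2 * t * |μ - ν|)
    {S : Set (SupStrategy X Outcome)} (hSne : S.Nonempty) {M : ℝ} {T : ℕ} (hM : 2 ≤ T * M)
    (hS : ∀ s ∈ S, ∃ w μ, ‖w‖ ≤ 1 ∧ 0 ≤ μ ∧ μ ≤ M ∧ s = affineStrategy z o μ w) :
    supValue squareLoss S T ≤ 100 * Real.sqrt (T * Real.log (T * M)) := by
  borelize E
  have hT : 0 < T := by
    rcases Nat.eq_zero_or_pos T with rfl | h
    · norm_num at hM
    · exact h
  have hT1 : (1 : ℝ) ≤ T := by exact_mod_cast hT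
  have hlog : 1 / 4 ≤ Real.log (T * M) := by
    have := Real.log_le_log two_pos hM
    linarith [Real.log_two_gt_d9]
  set l := Real.log (T * M)
  -- When $T<l$ the trivial bound $4T$ is enough; otherwise $l\le\sqrt{Tl}$ absorbs the grid cost.
  rcases lt_or_ge (T : ℝ) l with h | h
  · have h1 : (T : ℝ) ≤ Real.sqrt (T * l) := Real.le_sqrt_of_sq_le (by nlinarith)
    linarith [supValue_squareLoss_le hSne T, Real.sqrt_nonneg (T * l)]
  · have h1 : l ≤ Real.sqrt (T * l) := Real.le_sqrt_of_sq_le (by nlinarith)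
    have h2 : Real.sqrt T ≤ 2 * Real.sqrt (T * l) := by
      rw [Real.sqrt_le_left (by positivity), mul_pow, Real.sq_sqrt (by positivity)]
      nlinarith
    have hMT : 0 ≤ M * (T : ℝ) ^ 2 := by nlinarith
    have h3 := supValue_le_of_affineStrategy hz hlip hSne hS (N := ⌊M * (T : ℝ) ^ 2⌋₊ + 1) hT
      (by push_cast; exact Nat.lt_floor_add_one _) (Nat.succ_pos _)
    -- The surplus $\log T$ is absorbed by $2\sqrt T$; a direct comparison with $l$ is not
    -- available, since $\lambda_{\min}$ may be of order $T$.
    have h4 : Real.log ((⌊M * (T : ℝ) ^ 2⌋₊ + 1 : ℕ) : ℝ) ≤ 2 * l + 2 * Real.sqrt T := by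
      have h5 : ((⌊M * (T : ℝ) ^ 2⌋₊ + 1 : ℕ) : ℝ) ≤ (T * M) * (T * M) * T := by
        push_cast
        have := Nat.floor_le hMT
        nlinarith
      have h6 := Real.log_le_log (by positivity) h5
      rw [Real.log_mul (by nlinarith) (by positivity), Real.log_mul (by linarith) (by linarith)] at h6
      have h7 : Real.log T = 2 * Real.log (Real.sqrt T) := by
        rw [Real.log_sqrt (by positivity)]; ring
      have h8 := Real.log_le_sub_one_of_pos (Real.sqrt_pos.2 (by positivity : (0 : ℝ) < T))
      change _ ≤ l + l + Real.log T at h6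
      linarith
    have h5 : 1 ≤ Real.sqrt T := Real.one_le_sqrt.2 hT1
    linarith

lemma resolventAt_zero {E : Type*} [NormedAddCommGroup E] [InnerProductSpace ℝ E]
    (G : E →ₗ[ℝ] E) (v : E) : resolventAt G 0 v = v := by
  simp [resolventAt]

lemma norm_coe_le_one {E : Type*} [NormedAddCommGroup E] {X : Set E}
    (hX : X ⊆ Metric.closedBall 0 1) (a : X) : ‖(a : E)‖ ≤ 1 :=
  mem_closedBall_zero_iff.1 (hX a.2)

/-! ### The two ridge classes as affine families. -/

section Classes

variable {d : ℕ} {X : Set (EuclideanSpace ℝ (Fin d))}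

/-- The Gram operator of the side information of the past rounds. -/
noncomputable def pastGram (t : ℕ) (x : Fin (t + 1) → X) :
    EuclideanSpace ℝ (Fin d) →ₗ[ℝ] EuclideanSpace ℝ (Fin d) :=
  gramOp fun i : Fin t => (x i.castSucc : EuclideanSpace ℝ (Fin d))

/-- The ridge regression weights with regularization `μ⁻¹`, centred at the origin. -/
noncomputable def ridgeVec (t : ℕ) (x : Fin (t + 1) → X) (y : Fin t → Outcome) (μ : ℝ) :
    EuclideanSpace ℝ (Fin d) :=
  μ • resolventAt (pastGram t x) μ
    (momentVec (fun i : Fin t => (x i.castSucc : EuclideanSpace ℝ (Fin d))) fun i => (y i : ℝ))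

/-- The contribution of the past rounds to the ridge regression prediction. -/
noncomputable def ridgeOffset (t : ℕ) (x : Fin (t + 1) → X) (y : Fin t → Outcome) (μ : ℝ) : ℝ :=
  inner ℝ (x (Fin.last t) : EuclideanSpace ℝ (Fin d)) (ridgeVec t x y μ)

lemma abs_ridgeOffset_sub_le (hX : X ⊆ Metric.closedBall 0 1) (t : ℕ) (x : Fin (t + 1) → X)
    (y : Fin t → Outcome) {μ ν : ℝ} (hμ : 0 ≤ μ) (hν : 0 ≤ ν) :
    |ridgeOffset t x y μ - ridgeOffset t x y ν| ≤ t * |μ - ν| := by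
  rw [ridgeOffset, ridgeOffset, ← inner_sub_right]
  calc _ ≤ ‖(x (Fin.last t) : EuclideanSpace ℝ (Fin d))‖ * ‖ridgeVec t x y μ - ridgeVec t x y ν‖ :=
        abs_real_inner_le_norm _ _
    _ ≤ 1 * (|μ - ν| * t) := by
        gcongr
        · exact norm_coe_le_one hX _
        · refine (norm_smul_resolventAt_sub_le (inner_gramOp_self_nonneg _) hμ hν _).trans ?_
          gcongr
          exact norm_momentVec_le _ (fun i => norm_coe_le_one hX _) _ fun i => abs_le.2 (y i).2
    _ = t * |μ - ν| := by ring

lemma supValue_rlsClass_le (hne : X.Nonempty) (hX : X ⊆ Metric.closedBall 0 1) {lamMin : ℝ}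
    (hlam : 0 < lamMin) {T : ℕ} (hT : 2 ≤ (T : ℝ) * lamMin⁻¹) :
    supValue squareLoss (rlsClass X lamMin) T
      ≤ 100 * Real.sqrt ((T : ℝ) * Real.log ((T : ℝ) * lamMin⁻¹)) := by
  have hS : (rlsClass X lamMin).Nonempty := ⟨staticStrategy X 0, 0, by simp, Or.inr rfl⟩
  have : Nonempty X := hne.to_subtype
  refine supValue_le_mul_sqrt (X := X)
    (z := fun t x _ _ => (x (Fin.last t) : EuclideanSpace ℝ (Fin d))) (o := ridgeOffset)
    (fun t x y μ _ => norm_coe_le_one hX _) ?_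
    hS hT ?_
  · intro w _ t x y μ ν hμ hν
    rw [add_sub_add_left_eq_sub]
    refine (abs_ridgeOffset_sub_le hX t x y hμ hν).trans ?_
    have : 0 ≤ (t : ℝ) * |μ - ν| := by positivity
    linarith
  · rintro s ⟨w₀, hw₀, ⟨lam, hl, rfl⟩ | rfl⟩
    · have hpos : 0 < lam := hlam.trans_le hl
      refine ⟨w₀, lam⁻¹, hw₀, by positivity, by gcongr, ?_⟩
      funext t x y
      simp only [rlsStrategy, affineStrategy, ridgeOffset, ridgeVec, pastGram, rlsWeight_eq hpos,
        ← inner_add_right]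
      rw [real_inner_comm]
    -- The parameter $\lambda=\infty$ is $\mu=0$, where the offset vanishes.
    · refine ⟨w₀, 0, hw₀, le_rfl, by positivity, ?_⟩
      funext t x y
      simp [staticStrategy, affineStrategy, ridgeOffset, ridgeVec, real_inner_comm]

lemma supValue_rlsArgminClass_le (hne : X.Nonempty) (hX : X ⊆ Metric.closedBall 0 1) {lamMin : ℝ}
    (hlam : 0 < lamMin) {T : ℕ} (hT : 2 ≤ (T : ℝ) * lamMin⁻¹) :
    supValue squareLoss (rlsArgminClass X lamMin) T
      ≤ 100 * Real.sqrt ((T : ℝ) * Real.log ((T : ℝ) * lamMin⁻¹)) := by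
  have hS : (rlsArgminClass X lamMin).Nonempty := ⟨staticStrategy X 0, 0, by simp, Or.inr rfl⟩
  have : Nonempty X := hne.to_subtype
  have hG : ∀ (t : ℕ) (x : Fin (t + 1) → X) v, 0 ≤ inner ℝ (pastGram t x v) v :=
    fun t x => inner_gramOp_self_nonneg _
  refine supValue_le_mul_sqrt (X := X)
    (z := fun t x _ μ => resolventAt (pastGram t x) μ
      (x (Fin.last t) : EuclideanSpace ℝ (Fin d))) (o := ridgeOffset)
    (fun t x y μ hμ => (norm_resolventAt_le (hG t x) hμ _).trans (norm_coe_le_one hX _)) ?_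
    hS hT ?_
  · intro w hw t x y μ ν hμ hν
    rw [add_sub_add_comm, ← inner_sub_left]
    refine (abs_add_le _ _).trans ?_
    have h1 := abs_ridgeOffset_sub_le hX t x y hμ hν
    have h2 : |inner ℝ (resolventAt (pastGram t x) μ (x (Fin.last t) : EuclideanSpace ℝ (Fin d)) -
        resolventAt (pastGram t x) ν (x (Fin.last t) : EuclideanSpace ℝ (Fin d))) w| ≤
          |μ - ν| * (t * 1) * 1 := by
      refine (abs_real_inner_le_norm _ _).trans ?_
      gcongr
      refine (norm_resolventAt_sub_le (hG t x) hμ hν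
        (norm_gramOp_le _ fun i => norm_coe_le_one hX _) (Nat.cast_nonneg t) _).trans ?_
      gcongr
      exact norm_coe_le_one hX _
    linarith
  · rintro s ⟨w₀, hw₀, ⟨lam, hl, hs⟩ | rfl⟩
    · have hpos : 0 < lam := hlam.trans_le hl
      have hinv : 0 ≤ lam⁻¹ := by positivity
      refine ⟨w₀, lam⁻¹, hw₀, hinv, by gcongr, ?_⟩
      funext t x y
      obtain ⟨w, hmin, hw⟩ := hs t x y
      have hw' : w = resolventAt (pastGram t x) lam⁻¹ _ :=
        eq_of_isMinOn_rlsObjective hpos w₀ _ _ hmin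
      -- Symmetry moves the resolvent from the feature back onto $w_0$, so the two inner products
      -- with $x_t$ combine into one with the minimizer.
      rw [hw, affineStrategy, ridgeOffset, ridgeVec,
        inner_resolventAt_comm (hG t x) (gramOp_isSymmetric _) hinv, ← inner_add_right,
        ← map_smul, ← map_add, ← hw', real_inner_comm]
    · refine ⟨w₀, 0, hw₀, le_rfl, by positivity, ?_⟩
      funext t x y
      simp [staticStrategy, affineStrategy, ridgeOffset, ridgeVec, resolventAt_zero,
        real_inner_comm]

end Classes

theorem lemma4 :
    ∃ c : ℝ, 0 < c ∧
      ∀ (d T : ℕ) (X : Set (EuclideanSpace ℝ (Fin d))), X.Nonempty →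
        X ⊆ Metric.closedBall 0 1 →
        ∀ lamMin : ℝ, 0 < lamMin → 2 * lamMin ≤ (T : ℝ) →
          supValue squareLoss (rlsClass X lamMin) T
              ≤ c * Real.sqrt ((T : ℝ) * Real.log ((T : ℝ) * lamMin⁻¹)) ∧
          supValue squareLoss (rlsArgminClass X lamMin) T
              ≤ c * Real.sqrt ((T : ℝ) * Real.log ((T : ℝ) * lamMin⁻¹)) := by
  refine ⟨100, by norm_num, fun d T X hne hX lamMin hlam hT => ?_⟩
  have h : 2 ≤ (T : ℝ) * lamMin⁻¹ := by
    rwa [← div_eq_mul_inv, le_div_iff₀ hlam]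
  exact ⟨supValue_rlsClass_le hne hX hlam h, supValue_rlsArgminClass_le hne hX hlam h⟩
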